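/- Let $a,b>0$ be real numbers and let \[ \Phi_{a,b}(z)=\sum_{k=0}^{\infty}\frac{(a)_k}{(a+b)_k}\,\frac{z^k}{k!},\qquad (x)_k=x(x+1)\cdots(x+k-1), \] be the Kummer function $M(a,a+b;z)$, an entire function of $z\in\mathbb{C}$ with $\Phi_{a,b}(0)=1$. Define the hypergeometric zeta function by \[ \zeta^{H}_{a,b}(s)=\sum_{z_j}\frac{1}{z_j^{\,s}},\qquad \operatorname{Re}s>1, \] where $z_j$ runs over all complex zeros of $\Phi_{a,b}$, repeated according to multiplicity, and complex powers are principal (for integer $s$ the branch is immaterial). Then the series for $\zeta^H_{a,b}(n)$ converges absolutely for every integer $n\ge 2$, and for every integer $p\ge 1$, \[ \sum_{k=1}^{p-1}\zeta^{H}_{a,b}(k+1)\,\zeta^{H}_{a,b}(p-k+1)=(a+b+p+1)\,\zeta^{H}_{a,b}(p+2)+\frac{a-b}{a+b}\,\zeta^{H}_{a,b}(p+1), \] where the sum on the left is empty (equal to $0$) for $p=1$. -/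

import Mathlib

noncomputable section

/-- The Kummer confluent hypergeometric function
`M(a, c; z) = ∑ₖ (a)ₖ / (c)ₖ * zᵏ / k!`, where `(x)ₖ` is the rising factorial. -/
def kummerM (a c z : ℂ) : ℂ :=
  ∑' k : ℕ, (ascPochhammer ℂ k).eval a / (ascPochhammer ℂ k).eval c * (z ^ k / (k.factorial : ℂ))

/-- `Φ_{a,b}(z) = M(a, a + b; z)` for real parameters `a`, `b`. -/
def kummerPhi (a b : ℝ) (z : ℂ) : ℂ :=
  kummerM (a : ℂ) ((a : ℂ) + (b : ℂ)) z

/-- The set of complex zeros of `Φ_{a,b}`. -/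
def kummerZeros (a b : ℝ) : Set ℂ :=
  {z | kummerPhi a b z = 0}

/-- The contribution `z^{-s}` of a zero `z` of `Φ_{a,b}` to the zeta series, counted with the
multiplicity of `z` as a zero of `Φ_{a,b}`. -/
def hypergeometricZetaTerm (a b : ℝ) (s : ℂ) (z : kummerZeros a b) : ℂ :=
  (analyticOrderNatAt (kummerPhi a b) (z : ℂ) : ℂ) * (1 / (z : ℂ) ^ s)

/-- The hypergeometric zeta function `ζ^H_{a,b}(s)`: the sum of `z^{-s}` over all complex zeros
`z` of `Φ_{a,b}`, repeated according to multiplicity. -/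
def hypergeometricZeta (a b : ℝ) (s : ℂ) : ℂ :=
  ∑' z : kummerZeros a b, hypergeometricZetaTerm a b s z

end

open Filter Topology Metric

/-! Let `u` be the logarithmic derivative of Φ at 0, with Taylor coefficients u_n. Kummer's equation
becomes a Riccati equation for `u` (`riccati_of_kummer`), and comparing coefficients gives a
quadratic recurrence for the u_n. It is the claimed identity once u_n = -ζ(n+1) is known for n ≥ 1.

That link (`tsum_analyticOrderNatAt_div_pow`) holds for any entire f with f(0) = 1 and |f(z)| ≤
exp|z|, and needs no Hadamard product. Divide out the zeros with |w| ≤ R. The quotient is zero-free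
in the disc, and its logarithm is O(R) by Borel–Carathéodory. Cauchy's estimate then bounds the
error in the n-th coefficient by O(R^(-n)), which vanishes as R → ∞. A Jensen-type zero count gives
absolute convergence. -/

/-! ### Dividing out zeros and counting them -/

/-- An entire function with a zero of order `n` at `w` is `(z - w) ^ n` times an entire function
that does not vanish at `w`. -/
theorem exists_eq_sub_pow_mul {f : ℂ → ℂ} (hf : Differentiable ℂ f) {w : ℂ} {n : ℕ}
    (hn : analyticOrderAt f w = n) :
    ∃ g : ℂ → ℂ, Differentiable ℂ g ∧ g w ≠ 0 ∧ ∀ z, f z = (z - w) ^ n * g z := by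
  induction n generalizing f with
  | zero =>
    refine ⟨f, hf, ?_, by simp⟩
    exact (hf.analyticAt w).analyticOrderAt_eq_zero.1 (by simpa using hn)
  | succ n ih =>
    have hfw : f w = 0 := by
      refine ((hf.analyticAt w).analyticOrderAt_ne_zero).1 ?_
      rw [hn]; exact_mod_cast Nat.succ_ne_zero n
    have hd : Differentiable ℂ (dslope f w) := by
      rw [← differentiableOn_univ] at hf ⊢
      exact (Complex.differentiableOn_dslope univ_mem).2 hf
    have heq : f = (fun z ↦ z - w) * dslope f w := by
      funext z
      have := sub_smul_dslope f w z
      simp only [smul_eq_mul, hfw, sub_zero] at this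
      simp [this]
    have hord : analyticOrderAt (dslope f w) w = n := by
      have h1 : analyticOrderAt (fun z : ℂ ↦ z - w) w = 1 := analyticOrderAt_id_sub_const_self
      rw [heq, analyticOrderAt_mul (by fun_prop) (hd.analyticAt w), h1, add_comm] at hn
      push_cast at hn
      exact ENat.add_left_injective_of_ne_top ENat.one_ne_top hn
    obtain ⟨g, hg, hgw, hfg⟩ := ih hd hord
    refine ⟨g, hg, hgw, fun z ↦ ?_⟩
    rw [heq, Pi.mul_apply, hfg z]
    ring

/-- An entire function that is not identically zero has finite order everywhere. -/
theorem analyticOrderAt_ne_top_of_entire {f : ℂ → ℂ} (hf : Differentiable ℂ f) (h0 : f 0 = 1)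
    (w : ℂ) : analyticOrderAt f w ≠ ⊤ := by
  intro h
  rw [AnalyticOnNhd.analyticOrderAt_eq_top_iff_eq_zero w fun z ↦ hf.analyticAt z] at h
  simp [h] at h0

/-- Extraction of finitely many zeros from an entire function. -/
theorem exists_eq_prod_mul {f : ℂ → ℂ} (hf : Differentiable ℂ f) (h0 : f 0 = 1)
    (S : Finset ℂ) (hS : ∀ w ∈ S, w ≠ 0) :
    ∃ g : ℂ → ℂ, Differentiable ℂ g ∧ (∀ w ∈ S, g w ≠ 0) ∧
      ∀ z, f z = (∏ w ∈ S, (1 - z / w) ^ analyticOrderNatAt f w) * g z := by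
  classical
  induction S using Finset.induction_on with
  | empty => exact ⟨f, hf, by simp, by simp⟩
  | insert w S hw ih =>
    obtain ⟨g, hg, hgS, hfg⟩ := ih fun x hx ↦ hS x (Finset.mem_insert_of_mem hx)
    have hw0 : w ≠ 0 := hS w (Finset.mem_insert_self w S)
    let P : ℂ → ℂ := fun z ↦ ∏ x ∈ S, (1 - z / x) ^ analyticOrderNatAt f x
    have hP : Differentiable ℂ P := by fun_prop
    have hPw : P w ≠ 0 := by
      refine Finset.prod_ne_zero_iff.2 fun x hx ↦ pow_ne_zero _ ?_
      have hx0 : x ≠ 0 := hS x (Finset.mem_insert_of_mem hx)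
      rw [sub_ne_zero, ne_comm, Ne, div_eq_one_iff_eq hx0]
      rintro rfl
      exact hw hx
    have hfP : f = P * g := funext hfg
    have hord : analyticOrderAt g w = analyticOrderNatAt f w := by
      rw [Nat.cast_analyticOrderNatAt (analyticOrderAt_ne_top_of_entire hf h0 w)]
      conv_rhs => rw [hfP]
      rw [analyticOrderAt_mul (hP.analyticAt w) (hg.analyticAt w),
        (hP.analyticAt w).analyticOrderAt_eq_zero.2 hPw, zero_add]
    obtain ⟨k, hk, hkw, hgk⟩ := exists_eq_sub_pow_mul hg hord
    refine ⟨fun z ↦ (-w) ^ analyticOrderNatAt f w * k z, by fun_prop, ?_, fun z ↦ ?_⟩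
    · intro x hx
      refine mul_ne_zero (pow_ne_zero _ (neg_ne_zero.2 hw0)) ?_
      rcases Finset.mem_insert.1 hx with rfl | hx
      · exact hkw
      · exact right_ne_zero_of_mul (hgk x ▸ hgS x hx)
    · have h : (1 - z / w) ^ analyticOrderNatAt f w * (-w) ^ analyticOrderNatAt f w =
          (z - w) ^ analyticOrderNatAt f w := by
        rw [← mul_pow]; congr 1; field_simp; ring
      rw [Finset.prod_insert hw, hfg z, hgk z, ← h]
      ring

/-- The quotient of an entire function of exponential type by the factors belonging to zeros in
the closed disc of radius `R` is bounded on the disc of radius `3 * R`. -/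
theorem norm_mul_le_of_eq_prod_mul {f g : ℂ → ℂ} (hb : ∀ z, ‖f z‖ ≤ Real.exp ‖z‖)
    (hg : Differentiable ℂ g) {R : ℝ} (hR : 0 < R) {S : Finset ℂ} {m : ℂ → ℕ}
    (hS : ∀ w ∈ S, w ≠ 0 ∧ ‖w‖ ≤ R) (hfg : ∀ z, f z = (∏ w ∈ S, (1 - z / w) ^ m w) * g z)
    {z : ℂ} (hz : ‖z‖ ≤ 3 * R) :
    ‖g z‖ ≤ Real.exp (3 * R) / 2 ^ (∑ w ∈ S, m w) := by
  have h3 : 3 * R ≠ 0 := by positivity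
  refine Complex.norm_le_of_forall_mem_frontier_norm_le (U := ball 0 (3 * R)) isBounded_ball
    hg.diffContOnCl (fun x hx ↦ ?_) (by simpa [closure_ball _ h3] using hz)
  rw [frontier_ball _ h3, mem_sphere_zero_iff_norm] at hx
  -- On |x| = 3R, |w| ≤ R forces |1 - x/w| ≥ 3 - 1 = 2; the maximum principle carries the bound
  -- inside.
  have hprod : (2 : ℝ) ^ (∑ w ∈ S, m w) ≤ ‖∏ w ∈ S, (1 - x / w) ^ m w‖ := by
    rw [← Finset.prod_pow_eq_pow_sum, norm_prod]
    refine Finset.prod_le_prod (fun _ _ ↦ by positivity) fun w hw ↦ ?_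
    rw [norm_pow]
    refine pow_le_pow_left₀ (by norm_num) ?_ _
    obtain ⟨hw0, hwR⟩ := hS w hw
    have hw' : 0 < ‖w‖ := norm_pos_iff.2 hw0
    have h1 : 3 ≤ ‖x / w‖ := by
      rw [norm_div, le_div_iff₀ hw', hx]
      gcongr
    have h2 := norm_sub_norm_le (x / w) 1
    rw [norm_one, norm_sub_rev] at h2
    linarith
  rw [le_div_iff₀ (by positivity), mul_comm]
  calc _ ≤ ‖∏ w ∈ S, (1 - x / w) ^ m w‖ * ‖g x‖ := by gcongr
    _ = ‖f x‖ := by rw [hfg x, norm_mul]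
    _ ≤ _ := hx ▸ hb x

/-- A Jensen-type bound: zeros of an entire function of exponential type in a disc, counted with
multiplicity, are at most proportional to the radius. -/
theorem sum_analyticOrderNatAt_le {f : ℂ → ℂ} (hf : Differentiable ℂ f) (h0 : f 0 = 1)
    (hb : ∀ z, ‖f z‖ ≤ Real.exp ‖z‖) {R : ℝ} (hR : 0 < R) (S : Finset ℂ)
    (hS : ∀ w ∈ S, f w = 0 ∧ ‖w‖ ≤ R) :
    ∑ w ∈ S, (analyticOrderNatAt f w : ℝ) ≤ 6 * R := by
  have hS' : ∀ w ∈ S, w ≠ 0 ∧ ‖w‖ ≤ R := fun w hw ↦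
    ⟨by rintro rfl; simpa [h0] using (hS 0 hw).1, (hS w hw).2⟩
  obtain ⟨g, hg, -, hfg⟩ := exists_eq_prod_mul hf h0 S fun w hw ↦ (hS' w hw).1
  have h := norm_mul_le_of_eq_prod_mul hb hg hR hS' hfg (z := 0) (by simpa using hR.le)
  have hg0 : g 0 = 1 := by simpa [h0] using (hfg 0).symm
  rw [hg0, norm_one, le_div_iff₀ (by positivity), one_mul] at h
  have h' := Real.log_le_log (by positivity) h
  rw [Real.log_pow, Real.log_exp] at h'
  push_cast at h'
  have hsum : (0 : ℝ) ≤ ∑ w ∈ S, (analyticOrderNatAt f w : ℝ) := by positivity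
  -- The count is at most 3R / log 2, and log 2 > 1/2.
  nlinarith [Real.log_two_gt_d9]

theorem one_le_analyticOrderNatAt {f : ℂ → ℂ} (hf : Differentiable ℂ f) (h0 : f 0 = 1)
    {w : ℂ} (hw : f w = 0) : 1 ≤ analyticOrderNatAt f w := by
  have h := (hf.analyticAt w).analyticOrderAt_ne_zero.2 hw
  rw [← Nat.cast_analyticOrderNatAt (analyticOrderAt_ne_top_of_entire hf h0 w)] at h
  exact Nat.one_le_iff_ne_zero.2 (by exact_mod_cast h)

/-- An entire function of exponential type has finitely many zeros in each disc. -/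
theorem finite_zeros_closedBall {f : ℂ → ℂ} (hf : Differentiable ℂ f) (h0 : f 0 = 1)
    (hb : ∀ z, ‖f z‖ ≤ Real.exp ‖z‖) (R : ℝ) : {w | f w = 0 ∧ ‖w‖ ≤ R}.Finite := by
  by_contra hinf
  have hR : 0 < max R 1 := by positivity
  obtain ⟨S, hS, hcard⟩ := Set.Infinite.exists_subset_card_eq hinf (⌊6 * max R 1⌋₊ + 1)
  have h := sum_analyticOrderNatAt_le hf h0 hb hR S fun w hw ↦
    ⟨(hS hw).1, (hS hw).2.trans (le_max_left _ _)⟩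
  have h1 : (S.card : ℝ) ≤ ∑ w ∈ S, (analyticOrderNatAt f w : ℝ) := by
    rw [← nsmul_one S.card]
    refine Finset.card_nsmul_le_sum _ _ _ fun w hw ↦ ?_
    exact_mod_cast one_le_analyticOrderNatAt hf h0 (hS hw).1
  have h2 := Nat.lt_floor_add_one (6 * max R 1)
  rw [hcard] at h1
  push_cast at h1
  linarith

/-! ### Logarithmic derivative versus finite power sums -/

/-- Derivatives at `0` of the logarithmic derivative of a zero-free bounded function. -/
theorem norm_iteratedDeriv_logDeriv_le {g : ℂ → ℂ} (hg : Differentiable ℂ g) (h0 : g 0 = 1)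
    {R M : ℝ} (hR : 0 < R) (hM : 0 < M) (hne : ∀ z ∈ ball (0 : ℂ) R, g z ≠ 0)
    (hb : ∀ z ∈ ball (0 : ℂ) R, ‖g z‖ ≤ Real.exp M) (n : ℕ) :
    ‖iteratedDeriv n (logDeriv g) 0‖ ≤ (n + 1).factorial * (2 * M) / (R / 2) ^ (n + 1) := by
  have hlog : DifferentiableOn ℂ (logDeriv g) (ball 0 R) :=
    (hg.deriv).differentiableOn.div hg.differentiableOn hne
  -- A primitive `h` of g'/g with h(0) = 0 is a logarithm of `g`: g·exp(-h) has zero derivative.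
  obtain ⟨h, hh0, hh⟩ := hlog.isExactOn_ball.with_val_at 0 0
  have hexp : ∀ z ∈ ball (0 : ℂ) R, g z * Complex.exp (-h z) = 1 := by
    intro z hz
    have hd : ∀ x ∈ ball (0 : ℂ) R, HasDerivAt (fun z ↦ g z * Complex.exp (-h z)) 0 x := by
      intro x hx
      have h1 := (hg x).hasDerivAt.mul ((hh x hx).fun_neg.cexp)
      convert! h1 using 1
      rw [logDeriv_apply]
      have := hne x hx
      field_simp
      ring
    have := isOpen_ball.is_const_of_deriv_eq_zero (isConnected_ball hR).isPreconnected
      (fun x hx ↦ (hd x hx).differentiableAt.differentiableWithinAt)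
      (fun x hx ↦ (hd x hx).deriv) hz (mem_ball_self hR)
    simpa [hh0, h0] using this
  have hgexp : ∀ z ∈ ball (0 : ℂ) R, g z = Complex.exp (h z) := by
    intro z hz
    have := hexp z hz
    rw [Complex.exp_neg] at this
    field_simp at this
    exact this
  have hdiff : DifferentiableOn ℂ h (ball 0 R) := fun z hz ↦
    (hh z hz).differentiableAt.differentiableWithinAt
  have hre : Set.MapsTo h (ball 0 R) {z | z.re ≤ M} := by
    intro z hz
    have := hb z hz
    rwa [hgexp z hz, Complex.norm_exp, Real.exp_le_exp] at this
  -- At radius r = R/2 the Borel–Carathéodory factor 2r/(R - r) equals 2.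
  have hle : ∀ z ∈ sphere (0 : ℂ) (R / 2), ‖h z‖ ≤ 2 * M := by
    intro z hz
    rw [mem_sphere_zero_iff_norm] at hz
    have := Complex.borelCaratheodory_zero hM hdiff hre hR
      (mem_ball_zero_iff.2 (by linarith : ‖z‖ < R)) hh0
    rw [hz] at this
    refine this.trans_eq ?_
    field_simp
    ring
  have hev : logDeriv g =ᶠ[𝓝 0] deriv h := by
    filter_upwards [ball_mem_nhds 0 hR] with z hz using (hh z hz).deriv.symm
  rw [hev.iteratedDeriv_eq n, ← iteratedDeriv_succ']
  refine Complex.norm_iteratedDeriv_le_of_forall_mem_sphere_norm_le (n + 1) (by positivity) ?_ hle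
  refine (hdiff.mono ?_).diffContOnCl
  exact (closure_ball_subset_closedBall).trans (closedBall_subset_ball (by linarith))

theorem iteratedDeriv_inv_sub {w : ℂ} (hw : w ≠ 0) (n : ℕ) :
    iteratedDeriv n (fun z ↦ (z - w)⁻¹) 0 = -(n.factorial / w ^ (n + 1)) := by
  have h := congrFun (iter_deriv_inv_linear_sub n (1 : ℂ) w) 0
  rw [← iteratedDeriv_eq_iterate] at h
  simp only [one_mul] at h
  rw [h, show (-1 - n : ℤ) = -((n + 1 : ℕ) : ℤ) by push_cast; ring, zpow_neg, zpow_natCast,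
    zero_sub, neg_pow w]
  field_simp
  rw [one_pow, pow_succ, mul_comm ((-1 : ℂ) ^ n)]
  simp

/-- Comparison of the Taylor coefficients of `f' / f` with power sums over the zeros of `f` in a
disc. -/
theorem norm_iteratedDeriv_logDeriv_add_sum_le {f : ℂ → ℂ} (hf : Differentiable ℂ f)
    (h0 : f 0 = 1) (hb : ∀ z, ‖f z‖ ≤ Real.exp ‖z‖) {R : ℝ} (hR : 0 < R) (S : Finset ℂ)
    (hS : ∀ w, w ∈ S ↔ f w = 0 ∧ ‖w‖ ≤ R) (n : ℕ) :
    ‖iteratedDeriv n (logDeriv f) 0 / n.factorial +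
      ∑ w ∈ S, (analyticOrderNatAt f w : ℂ) * (1 / w ^ (n + 1))‖ ≤
      (n + 1) * 12 * 2 ^ n / R ^ n := by
  have hS' : ∀ w ∈ S, w ≠ 0 ∧ ‖w‖ ≤ R := fun w hw ↦
    ⟨by rintro rfl; simpa [h0] using ((hS 0).1 hw).1, ((hS w).1 hw).2⟩
  obtain ⟨g, hg, hgS, hfg⟩ := exists_eq_prod_mul hf h0 S fun w hw ↦ (hS' w hw).1
  have hg0 : g 0 = 1 := by simpa [h0] using (hfg 0).symm
  -- A zero of `g` in the disc would be a zero of `f`, hence in `S`, where `g` does not vanish.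
  have hgne : ∀ z ∈ ball (0 : ℂ) R, g z ≠ 0 := by
    intro z hz hgz
    refine hgS z ((hS z).2 ⟨by rw [hfg z, hgz, mul_zero], ?_⟩) hgz
    exact (mem_ball_zero_iff.1 hz).le
  have hgb : ∀ z ∈ ball (0 : ℂ) R, ‖g z‖ ≤ Real.exp (3 * R) := by
    intro z hz
    have hz' := mem_ball_zero_iff.1 hz
    refine (norm_mul_le_of_eq_prod_mul hb hg hR hS' hfg (by linarith)).trans ?_
    exact div_le_self (Real.exp_pos _).le (one_le_pow₀ (by norm_num))
  have key := norm_iteratedDeriv_logDeriv_le hg hg0 hR (by positivity) hgne hgb n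
  have hfz : ∀ᶠ z in 𝓝 (0 : ℂ), f z ≠ 0 :=
    hf.continuous.continuousAt.eventually_ne (by simp [h0])
  have hlog : logDeriv f =ᶠ[𝓝 0] fun z ↦
      (∑ w ∈ S, (analyticOrderNatAt f w : ℂ) * (z - w)⁻¹) + logDeriv g z := by
    filter_upwards [hfz] with z hz
    have hfz' := hfg z
    have hprod : ∏ w ∈ S, (1 - z / w) ^ analyticOrderNatAt f w ≠ 0 :=
      left_ne_zero_of_mul (hfz' ▸ hz)
    have hgz : g z ≠ 0 := right_ne_zero_of_mul (hfz' ▸ hz)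
    have hfac := Finset.prod_ne_zero_iff.1 hprod
    conv_lhs => rw [show f = fun z ↦ (∏ w ∈ S, (1 - z / w) ^ analyticOrderNatAt f w) * g z from
      funext hfg]
    rw [logDeriv_mul z hprod hgz (by fun_prop) (hg z), logDeriv_prod hfac (by fun_prop)]
    congr 1
    refine Finset.sum_congr rfl fun w hw ↦ ?_
    rw [logDeriv_fun_pow (by fun_prop)]
    rcases Nat.eq_zero_or_pos (analyticOrderNatAt f w) with hm | hm
    · simp [hm]
    have hw0 := (hS' w hw).1
    have h1 : 1 - z / w ≠ 0 := fun h ↦ hfac w hw (by rw [h, zero_pow hm.ne'])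
    have h2 : w - z ≠ 0 := fun h ↦ h1 (by rw [← sub_eq_zero.1 h, div_self hw0, sub_self])
    have h3 : z - w ≠ 0 := by rwa [← neg_sub, neg_ne_zero]
    congr 1
    have hder : deriv (fun z ↦ 1 - z / w) z = -(1 / w) := by
      rw [deriv_const_sub, deriv_div_const, deriv_id'']
    rw [logDeriv_apply, hder]
    field_simp
    ring
  have hcd : ∀ w ∈ S, ContDiffAt ℂ n (fun z ↦ (analyticOrderNatAt f w : ℂ) * (z - w)⁻¹) 0 := by
    intro w hw
    refine contDiffAt_const.mul (ContDiffAt.inv (by fun_prop) ?_)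
    simpa using (hS' w hw).1
  have hcg : ContDiffAt ℂ n (logDeriv g) 0 :=
    ((hg.deriv.analyticAt 0).div (hg.analyticAt 0) (by simp [hg0])).contDiffAt
  have hsum : iteratedDeriv n (logDeriv f) 0 =
      -(n.factorial * ∑ w ∈ S, (analyticOrderNatAt f w : ℂ) * (1 / w ^ (n + 1))) +
        iteratedDeriv n (logDeriv g) 0 := by
    rw [hlog.iteratedDeriv_eq n]
    have := iteratedDeriv_add (x := (0 : ℂ)) (n := n) (ContDiffAt.sum hcd) hcg
    simp only [Pi.add_def] at this
    rw [this, iteratedDeriv_fun_sum hcd, Finset.mul_sum, ← Finset.sum_neg_distrib]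
    congr 1
    refine Finset.sum_congr rfl fun w hw ↦ ?_
    rw [iteratedDeriv_const_mul_field, iteratedDeriv_inv_sub (hS' w hw).1]
    ring
  have hn : (n.factorial : ℂ) ≠ 0 := by exact_mod_cast n.factorial_ne_zero
  have heq : iteratedDeriv n (logDeriv f) 0 / n.factorial +
      ∑ w ∈ S, (analyticOrderNatAt f w : ℂ) * (1 / w ^ (n + 1)) =
      iteratedDeriv n (logDeriv g) 0 / n.factorial := by
    rw [hsum]; field_simp; ring
  rw [heq, norm_div, Complex.norm_natCast, div_le_iff₀ (by positivity)]
  refine key.trans_eq ?_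
  rw [Nat.factorial_succ, div_pow, pow_succ R, pow_succ (2 : ℝ)]
  push_cast
  field_simp
  ring

/-! ### Convergence and values of the power sums -/

/-- The zero count applied with R = |w| to the single zero `w`. -/
theorem one_le_six_mul_norm_of_zero {f : ℂ → ℂ} (hf : Differentiable ℂ f) (h0 : f 0 = 1)
    (hb : ∀ z, ‖f z‖ ≤ Real.exp ‖z‖) {w : ℂ} (hw : f w = 0) : 1 ≤ 6 * ‖w‖ := by
  have hw0 : w ≠ 0 := by
    rintro rfl
    simp [h0] at hw
  have h := sum_analyticOrderNatAt_le hf h0 hb (norm_pos_iff.2 hw0) {w} (by simpa using hw)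
  have h1 : (1 : ℝ) ≤ analyticOrderNatAt f w := by
    exact_mod_cast one_le_analyticOrderNatAt hf h0 hw
  simpa using h1.trans (by simpa using h)

/-- Partial sums of the inverse squares of the zeros of an entire function of exponential type. -/
theorem sum_analyticOrderNatAt_div_sq_le {f : ℂ → ℂ} (hf : Differentiable ℂ f) (h0 : f 0 = 1)
    (hb : ∀ z, ‖f z‖ ≤ Real.exp ‖z‖) (S : Finset ℂ) (hS : ∀ w ∈ S, f w = 0) :
    ∑ w ∈ S, (analyticOrderNatAt f w : ℝ) / (6 * ‖w‖) ^ 2 ≤ 4 := by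
  classical
  -- Sort the zeros into dyadic shells of 6|w|. Shell j carries multiplicity at most 2^(j+1) and
  -- weights at most 4^(-j), so it contributes at most 2·2^(-j).
  have hex : ∀ w, ∃ k : ℕ, w ∈ S → 2 ^ k ≤ 6 * ‖w‖ ∧ 6 * ‖w‖ < 2 ^ (k + 1) := by
    intro w
    by_cases hw : w ∈ S
    · obtain ⟨k, hk⟩ := exists_nat_pow_near (one_le_six_mul_norm_of_zero hf h0 hb (hS w hw))
        (one_lt_two : (1 : ℝ) < 2)
      exact ⟨k, fun _ ↦ hk⟩
    · exact ⟨0, fun h ↦ absurd h hw⟩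
  choose k hk using hex
  obtain ⟨N, hN⟩ : ∃ N, ∀ w ∈ S, k w ∈ Finset.range N := by
    refine ⟨S.sup k + 1, fun w hw ↦ ?_⟩
    exact Finset.mem_range.2 (Nat.lt_succ_of_le (Finset.le_sup hw))
  rw [← Finset.sum_fiberwise_of_maps_to hN]
  have hj : ∀ j ∈ Finset.range N,
      ∑ w ∈ S with k w = j, (analyticOrderNatAt f w : ℝ) / (6 * ‖w‖) ^ 2 ≤ 2 * (1 / 2) ^ j := by
    intro j _
    have h1 := sum_analyticOrderNatAt_le hf h0 hb (R := 2 ^ (j + 1) / 6) (by positivity)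
      (S.filter fun w ↦ k w = j) (fun w hw ↦ by
        obtain ⟨hwS, rfl⟩ := Finset.mem_filter.1 hw
        exact ⟨hS w hwS, by linarith [(hk w hwS).2]⟩)
    calc _ ≤ ∑ w ∈ S with k w = j, (analyticOrderNatAt f w : ℝ) / (2 ^ j) ^ 2 := by
          refine Finset.sum_le_sum fun w hw ↦ ?_
          obtain ⟨hwS, rfl⟩ := Finset.mem_filter.1 hw
          have := (hk w hwS).1
          gcongr
      _ = (∑ w ∈ S with k w = j, (analyticOrderNatAt f w : ℝ)) / (2 ^ j) ^ 2 :=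
          (Finset.sum_div _ _ _).symm
      _ ≤ 6 * (2 ^ (j + 1) / 6) / (2 ^ j) ^ 2 := by gcongr
      _ = _ := by rw [pow_succ, one_div, inv_pow]; field_simp
  refine (Finset.sum_le_sum hj).trans ?_
  rw [← Finset.mul_sum]
  linarith [summable_geometric_two.sum_le_tsum (Finset.range N) (fun _ _ ↦ by positivity),
    tsum_geometric_two]

/-- Absolute convergence of the power sums of the zeros of an entire function of exponential
type. -/
theorem summable_analyticOrderNatAt_div_pow {f : ℂ → ℂ} (hf : Differentiable ℂ f) (h0 : f 0 = 1)
    (hb : ∀ z, ‖f z‖ ≤ Real.exp ‖z‖) {n : ℕ} (hn : 2 ≤ n) :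
    Summable fun w : {w | f w = 0} ↦
      (analyticOrderNatAt f (w : ℂ) : ℂ) * (1 / (w : ℂ) ^ n) := by
  have hsq : Summable fun w : {w | f w = 0} ↦
      (analyticOrderNatAt f (w : ℂ) : ℝ) / (6 * ‖(w : ℂ)‖) ^ 2 := by
    refine summable_of_sum_le (c := 4) (fun w ↦ by positivity) fun S ↦ ?_
    have h := sum_analyticOrderNatAt_div_sq_le hf h0 hb
      (S.map (Function.Embedding.subtype _)) (fun w hw ↦ by
        obtain ⟨x, -, rfl⟩ := Finset.mem_map.1 hw
        exact x.2)
    simpa only [Finset.sum_map, Function.Embedding.subtype_apply] using h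
  refine Summable.of_norm_bounded (hsq.mul_left (6 ^ n)) fun w ↦ ?_
  have h1 := one_le_six_mul_norm_of_zero hf h0 hb w.2
  rw [norm_mul, norm_div, norm_pow, norm_one, Complex.norm_natCast]
  have hw : 0 < ‖(w : ℂ)‖ := by linarith
  have h2 : 6 ^ n * ((analyticOrderNatAt f (w : ℂ) : ℝ) / (6 * ‖(w : ℂ)‖) ^ n) =
      analyticOrderNatAt f (w : ℂ) * (1 / ‖(w : ℂ)‖ ^ n) := by
    rw [mul_pow]; field_simp
  rw [← h2]
  gcongr

/-- The power sums of the zeros of an entire function of exponential type are the negatives of the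
Taylor coefficients of its logarithmic derivative. -/
theorem tsum_analyticOrderNatAt_div_pow {f : ℂ → ℂ} (hf : Differentiable ℂ f) (h0 : f 0 = 1)
    (hb : ∀ z, ‖f z‖ ≤ Real.exp ‖z‖) {n : ℕ} (hn : 1 ≤ n) :
    ∑' w : {w | f w = 0}, (analyticOrderNatAt f (w : ℂ) : ℂ) * (1 / (w : ℂ) ^ (n + 1)) =
      -(iteratedDeriv n (logDeriv f) 0 / n.factorial) := by
  classical
  have hfin : ∀ N : ℕ, {w | f w = 0 ∧ ‖w‖ ≤ (N : ℝ)}.Finite := fun N ↦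
    finite_zeros_closedBall hf h0 hb N
  let S : ℕ → Finset ℂ := fun N ↦ (hfin N).toFinset
  have hS : ∀ N w, w ∈ S N ↔ f w = 0 ∧ ‖w‖ ≤ (N : ℝ) := fun N w ↦ (hfin N).mem_toFinset
  let T : ℕ → Finset {w | f w = 0} := fun N ↦ (S N).subtype (· ∈ {w | f w = 0})
  have hT : Tendsto T atTop atTop := by
    refine tendsto_atTop_finset_of_monotone (fun M N hMN w hw ↦ ?_) fun w ↦ ?_
    · rw [Finset.mem_subtype, hS] at hw ⊢
      exact ⟨hw.1, hw.2.trans (by exact_mod_cast hMN)⟩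
    · obtain ⟨N, hN⟩ := exists_nat_ge ‖(w : ℂ)‖
      exact ⟨N, Finset.mem_subtype.2 ((hS N w).2 ⟨w.2, hN⟩)⟩
  have h1 := ((summable_analyticOrderNatAt_div_pow hf h0 hb
    (by omega : 2 ≤ n + 1)).hasSum.comp hT)
  refine tendsto_nhds_unique h1 ?_
  rw [tendsto_iff_norm_sub_tendsto_zero]
  -- The decay needs n ≥ 1; for n = 0 the error bound does not tend to 0.
  have hlim : Tendsto (fun N : ℕ ↦ (n + 1) * 12 * 2 ^ n / (N : ℝ) ^ n) atTop (𝓝 0) :=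
    tendsto_const_nhds.div_atTop
      ((tendsto_pow_atTop (by omega)).comp tendsto_natCast_atTop_atTop)
  refine squeeze_zero' (Eventually.of_forall fun _ ↦ norm_nonneg _) ?_ hlim
  filter_upwards [eventually_gt_atTop 0] with N hN
  refine le_trans (le_of_eq ?_) (norm_iteratedDeriv_logDeriv_add_sum_le hf h0 hb
    (R := N) (by exact_mod_cast hN) (S N) (hS N) n)
  rw [sub_neg_eq_add, add_comm]
  congr 2
  simp only [Function.comp_apply, T]
  exact Finset.sum_subtype_of_mem (fun w : ℂ ↦ (analyticOrderNatAt f w : ℂ) * (1 / w ^ (n + 1)))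
    fun w hw ↦ ((hS N w).1 hw).1

/-! ### Formal Taylor series and the Riccati equation -/

/-- The formal Taylor series at `0`. -/
noncomputable def taylorPowerSeries (f : ℂ → ℂ) : PowerSeries ℂ :=
  PowerSeries.mk fun n ↦ iteratedDeriv n f 0 / n.factorial

theorem coeff_taylorPowerSeries (f : ℂ → ℂ) (n : ℕ) :
    PowerSeries.coeff n (taylorPowerSeries f) = iteratedDeriv n f 0 / n.factorial :=
  PowerSeries.coeff_mk _ _

theorem taylorPowerSeries_congr {f g : ℂ → ℂ} (h : f =ᶠ[𝓝 0] g) :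
    taylorPowerSeries f = taylorPowerSeries g := by
  ext n
  rw [coeff_taylorPowerSeries, coeff_taylorPowerSeries, h.iteratedDeriv_eq n]

theorem taylorPowerSeries_mul {f g : ℂ → ℂ} (hf : AnalyticAt ℂ f 0) (hg : AnalyticAt ℂ g 0) :
    taylorPowerSeries (f * g) = taylorPowerSeries f * taylorPowerSeries g := by
  ext n
  rw [PowerSeries.coeff_mul, coeff_taylorPowerSeries,
    iteratedDeriv_mul hf.contDiffAt hg.contDiffAt,
    Finset.Nat.sum_antidiagonal_eq_sum_range_succ_mk, Finset.sum_div]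
  refine Finset.sum_congr rfl fun i hi ↦ ?_
  rw [coeff_taylorPowerSeries, coeff_taylorPowerSeries,
    Nat.cast_choose ℂ (Nat.lt_succ_iff.1 (Finset.mem_range.1 hi))]
  have h1 : (n.factorial : ℂ) ≠ 0 := by exact_mod_cast n.factorial_ne_zero
  field_simp

theorem derivative_taylorPowerSeries (f : ℂ → ℂ) :
    PowerSeries.derivative ℂ (taylorPowerSeries f) = taylorPowerSeries (deriv f) := by
  ext n
  rw [PowerSeries.coeff_derivative, coeff_taylorPowerSeries, coeff_taylorPowerSeries,
    iteratedDeriv_succ', Nat.factorial_succ]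
  have h : (n : ℂ) + 1 ≠ 0 := by exact_mod_cast n.succ_ne_zero
  push_cast
  field_simp

theorem derivative_taylorPowerSeries_eq_logDeriv_mul {f : ℂ → ℂ} (hf : AnalyticAt ℂ f 0)
    (h0 : f 0 ≠ 0) :
    PowerSeries.derivative ℂ (taylorPowerSeries f) =
      taylorPowerSeries (logDeriv f) * taylorPowerSeries f := by
  have hlog : AnalyticAt ℂ (logDeriv f) 0 := hf.deriv.div hf h0
  rw [derivative_taylorPowerSeries, ← taylorPowerSeries_mul hlog hf]
  refine taylorPowerSeries_congr ?_
  filter_upwards [hf.continuousAt.eventually_ne h0] with z hz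
  rw [Pi.mul_apply, logDeriv_apply, div_mul_cancel₀ _ hz]

open PowerSeries in
/-- A solution of Kummer's equation has a logarithmic derivative solving a Riccati equation. -/
theorem riccati_of_kummer {a c : ℂ} {F u : PowerSeries ℂ} (hF : F ≠ 0)
    (hu : derivative ℂ F = u * F)
    (hode : X * derivative ℂ (derivative ℂ F) + (C c - X) * derivative ℂ F - C a * F = 0) :
    X * (derivative ℂ u + u * u) + (C c - X) * u - C a = 0 := by
  have h2 : derivative ℂ (derivative ℂ F) = (derivative ℂ u + u * u) * F := by
    rw [hu, Derivation.leibniz, hu]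
    simp only [smul_eq_mul]
    ring
  rw [h2, hu] at hode
  -- Power series over ℂ form a domain, so `F` cancels.
  refine (mul_eq_zero.1 (?_ : _ * F = 0)).resolve_right hF
  rw [← hode]
  ring

open PowerSeries in
theorem coeff_of_riccati {a c : ℂ} {u : PowerSeries ℂ}
    (h : X * (derivative ℂ u + u * u) + (C c - X) * u - C a = 0) (p : ℕ) :
    (p + 1 + c) * coeff (p + 1) u + ∑ k ∈ Finset.range (p + 1), coeff k u * coeff (p - k) u
      - coeff p u = 0 := by
  have := congrArg (coeff (p + 1)) h
  simp only [sub_mul, map_sub, map_add, coeff_succ_X_mul, coeff_derivative, coeff_C_mul, coeff_C,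
    map_zero] at this
  rw [if_neg p.succ_ne_zero, coeff_mul, Finset.Nat.sum_antidiagonal_eq_sum_range_succ_mk] at this
  rw [← this]
  ring

open PowerSeries in
theorem coeff_zero_of_riccati {a c : ℂ} {u : PowerSeries ℂ}
    (h : X * (derivative ℂ u + u * u) + (C c - X) * u - C a = 0) : c * coeff 0 u = a := by
  have := congrArg (coeff 0) h
  simpa [sub_mul, sub_eq_zero] using this

/-! ### The Kummer function: growth and differential equation -/

/-- The Taylor coefficients of `Φ_{a,b}`. -/
noncomputable def kummerCoeff (a b : ℝ) (k : ℕ) : ℝ :=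
  (ascPochhammer ℝ k).eval a / (ascPochhammer ℝ k).eval (a + b) / k.factorial

theorem ofReal_eval_ascPochhammer (x : ℝ) (k : ℕ) :
    (((ascPochhammer ℝ k).eval x : ℝ) : ℂ) = (ascPochhammer ℂ k).eval (x : ℂ) := by
  induction k with
  | zero => simp
  | succ k ih => simp [ascPochhammer_succ_eval, ih]

theorem kummerCoeff_zero (a b : ℝ) : kummerCoeff a b 0 = 1 := by simp [kummerCoeff]

theorem kummerCoeff_succ {a b : ℝ} (ha : 0 < a) (hb : 0 < b) (k : ℕ) :
    (k + 1) * (a + b + k) * kummerCoeff a b (k + 1) = (a + k) * kummerCoeff a b k := by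
  have h1 := ascPochhammer_pos k (a + b) (by positivity)
  have h2 : 0 < a + b + k := by positivity
  rw [kummerCoeff, kummerCoeff, ascPochhammer_succ_eval, ascPochhammer_succ_eval,
    Nat.factorial_succ]
  push_cast
  field_simp

theorem kummerCoeff_nonneg {a b : ℝ} (ha : 0 < a) (hb : 0 < b) (k : ℕ) :
    0 ≤ kummerCoeff a b k := by
  have h1 := ascPochhammer_pos k (a + b) (by positivity)
  have h2 := ascPochhammer_pos k a ha
  rw [kummerCoeff]
  positivity

/-- Since b > 0, the rising factorial of a is at most that of a + b. This comparison with the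
exponential series yields |Φ(z)| ≤ exp|z|. -/
theorem kummerCoeff_le {a b : ℝ} (ha : 0 < a) (hb : 0 < b) (k : ℕ) :
    kummerCoeff a b k ≤ 1 / k.factorial := by
  have h1 := ascPochhammer_pos k (a + b) (by positivity)
  have h2 : (ascPochhammer ℝ k).eval a ≤ (ascPochhammer ℝ k).eval (a + b) := by
    clear h1
    induction k with
    | zero => simp
    | succ k ih =>
      have h1 := ascPochhammer_pos k (a + b) (by positivity)
      rw [ascPochhammer_succ_eval, ascPochhammer_succ_eval]
      gcongr
      linarith
  rw [kummerCoeff]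
  gcongr
  exact (div_le_one h1).2 h2

theorem norm_kummerCoeff_mul_pow_le {a b : ℝ} (ha : 0 < a) (hb : 0 < b) (z : ℂ) (k : ℕ) :
    ‖(kummerCoeff a b k : ℂ) * z ^ k‖ ≤ ‖z‖ ^ k / k.factorial := by
  rw [norm_mul, norm_pow, Complex.norm_of_nonneg (kummerCoeff_nonneg ha hb k), div_eq_mul_one_div,
    mul_comm]
  gcongr
  exact kummerCoeff_le ha hb k

theorem kummerPhi_eq_tsum (a b : ℝ) (z : ℂ) :
    kummerPhi a b z = ∑' k : ℕ, (kummerCoeff a b k : ℂ) * z ^ k := by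
  refine tsum_congr fun k ↦ ?_
  rw [kummerCoeff]
  push_cast [ofReal_eval_ascPochhammer]
  ring

theorem norm_kummerPhi_le {a b : ℝ} (ha : 0 < a) (hb : 0 < b) (z : ℂ) :
    ‖kummerPhi a b z‖ ≤ Real.exp ‖z‖ := by
  rw [kummerPhi_eq_tsum]
  refine tsum_of_norm_bounded ?_ (norm_kummerCoeff_mul_pow_le ha hb z)
  simpa [Real.exp_eq_exp_ℝ] using NormedSpace.expSeries_div_hasSum_exp ‖z‖

theorem hasFPowerSeriesOnBall_kummerPhi {a b : ℝ} (ha : 0 < a) (hb : 0 < b) :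
    HasFPowerSeriesOnBall (kummerPhi a b)
      (FormalMultilinearSeries.ofScalars ℂ fun k ↦ (kummerCoeff a b k : ℂ)) 0 ⊤ := by
  set p := FormalMultilinearSeries.ofScalars ℂ fun k ↦ (kummerCoeff a b k : ℂ) with hp
  have hrad : p.radius = ⊤ := by
    refine FormalMultilinearSeries.radius_eq_top_of_summable_norm p fun r ↦ ?_
    refine Summable.of_nonneg_of_le (fun _ ↦ by positivity) (fun k ↦ ?_)
      (Real.summable_pow_div_factorial (r : ℝ))
    have h := norm_kummerCoeff_mul_pow_le ha hb ((r : ℝ) : ℂ) k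
    rw [FormalMultilinearSeries.ofScalars_norm]
    simpa using h
  have h := p.hasFPowerSeriesOnBall (by simp [hrad])
  rw [hrad] at h
  convert! h using 1
  funext z
  rw [kummerPhi_eq_tsum, FormalMultilinearSeries.sum]
  simp [hp, mul_comm]

theorem differentiable_kummerPhi {a b : ℝ} (ha : 0 < a) (hb : 0 < b) :
    Differentiable ℂ (kummerPhi a b) := fun z ↦
  ((hasFPowerSeriesOnBall_kummerPhi ha hb).analyticAt_of_mem (by simp)).differentiableAt

theorem coeff_taylorPowerSeries_kummerPhi {a b : ℝ} (ha : 0 < a) (hb : 0 < b) (n : ℕ) :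
    PowerSeries.coeff n (taylorPowerSeries (kummerPhi a b)) = kummerCoeff a b n := by
  have h1 := (hasFPowerSeriesOnBall_kummerPhi ha hb).hasFPowerSeriesAt
  have h2 := h1.eq_formalMultilinearSeries h1.analyticAt.hasFPowerSeriesAt
  have h3 := congrArg (fun p ↦ p.coeff n) h2
  simp only [FormalMultilinearSeries.coeff_ofScalars] at h3
  rw [coeff_taylorPowerSeries, ← h3]

theorem kummerPhi_zero (a b : ℝ) : kummerPhi a b 0 = 1 := by
  rw [kummerPhi_eq_tsum, tsum_eq_single 0 fun k hk ↦ by simp [hk]]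
  simp [kummerCoeff_zero]

open PowerSeries in
theorem kummer_equation_taylorPowerSeries {a b : ℝ} (ha : 0 < a) (hb : 0 < b) :
    X * derivative ℂ (derivative ℂ (taylorPowerSeries (kummerPhi a b))) +
      (C ((a : ℂ) + b) - X) * derivative ℂ (taylorPowerSeries (kummerPhi a b)) -
      C (a : ℂ) * taylorPowerSeries (kummerPhi a b) = 0 := by
  ext n
  have h := congrArg (fun x : ℝ ↦ (x : ℂ)) (kummerCoeff_succ ha hb n)
  push_cast at h
  generalize (a : ℂ) + b = c at h ⊢
  cases n with
  | zero =>
    simp only [sub_mul, map_sub, map_add, coeff_zero_X_mul, coeff_derivative, coeff_C_mul,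
      coeff_taylorPowerSeries_kummerPhi ha hb, map_zero]
    push_cast at h ⊢
    linear_combination h
  | succ n =>
    simp only [sub_mul, map_sub, map_add, coeff_succ_X_mul, coeff_derivative, coeff_C_mul,
      coeff_taylorPowerSeries_kummerPhi ha hb, map_zero]
    push_cast at h ⊢
    linear_combination h

/-! ### The zeta recurrence -/

theorem hypergeometricZetaTerm_natCast (a b : ℝ) (n : ℕ) :
    hypergeometricZetaTerm a b n = fun z : {z | kummerPhi a b z = 0} ↦
      (analyticOrderNatAt (kummerPhi a b) (z : ℂ) : ℂ) * (1 / (z : ℂ) ^ n) := by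
  funext z
  rw [hypergeometricZetaTerm, Complex.cpow_natCast]

theorem hypergeometricZeta_add_one {a b : ℝ} (ha : 0 < a) (hb : 0 < b) {n : ℕ} (hn : 1 ≤ n) :
    hypergeometricZeta a b ((n : ℂ) + 1) =
      -PowerSeries.coeff n (taylorPowerSeries (logDeriv (kummerPhi a b))) := by
  rw [coeff_taylorPowerSeries, ← tsum_analyticOrderNatAt_div_pow (differentiable_kummerPhi ha hb)
    (kummerPhi_zero a b) (norm_kummerPhi_le ha hb) hn, hypergeometricZeta, ← Nat.cast_add_one,
    hypergeometricZetaTerm_natCast]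
  rfl

theorem mainTheorem5 (a b : ℝ) (ha : 0 < a) (hb : 0 < b) :
    (∀ n : ℕ, 2 ≤ n → Summable (hypergeometricZetaTerm a b (n : ℂ))) ∧
    ∀ p : ℕ, 1 ≤ p →
      ∑ k ∈ Finset.Ico 1 p,
          hypergeometricZeta a b ((k : ℂ) + 1) * hypergeometricZeta a b ((p : ℂ) - (k : ℂ) + 1) =
        ((a : ℂ) + (b : ℂ) + (p : ℂ) + 1) * hypergeometricZeta a b ((p : ℂ) + 2) +
          (((a : ℂ) - (b : ℂ)) / ((a : ℂ) + (b : ℂ))) * hypergeometricZeta a b ((p : ℂ) + 1) := by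
  have hf := differentiable_kummerPhi ha hb
  have h0 := kummerPhi_zero a b
  refine ⟨fun n hn ↦ ?_, fun p hp ↦ ?_⟩
  · rw [hypergeometricZetaTerm_natCast]
    exact summable_analyticOrderNatAt_div_pow hf h0 (norm_kummerPhi_le ha hb) hn
  have hF : taylorPowerSeries (kummerPhi a b) ≠ 0 := by
    intro h
    have := coeff_taylorPowerSeries_kummerPhi ha hb 0
    simp [h, kummerCoeff_zero] at this
  have hric := riccati_of_kummer hF
    (derivative_taylorPowerSeries_eq_logDeriv_mul (hf.analyticAt 0) (by simp [h0]))
    (kummer_equation_taylorPowerSeries ha hb)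
  have hzeta := fun n hn ↦ hypergeometricZeta_add_one (n := n) ha hb hn
  generalize taylorPowerSeries (logDeriv (kummerPhi a b)) = u at hric hzeta
  have hcoeff := coeff_of_riccati hric p
  have hzero := coeff_zero_of_riccati hric
  have hsum : ∑ k ∈ Finset.Ico 1 p, hypergeometricZeta a b ((k : ℂ) + 1) *
      hypergeometricZeta a b ((p : ℂ) - (k : ℂ) + 1) =
      ∑ k ∈ Finset.Ico 1 p, PowerSeries.coeff k u * PowerSeries.coeff (p - k) u := by
    refine Finset.sum_congr rfl fun k hk ↦ ?_
    obtain ⟨hk1, hkp⟩ := Finset.mem_Ico.1 hk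
    rw [← Nat.cast_sub hkp.le, hzeta k hk1,
      hzeta _ (by omega : 1 ≤ p - k), neg_mul_neg]
  have hp2 : (p : ℂ) + 2 = ((p + 1 : ℕ) : ℂ) + 1 := by push_cast; ring
  have hc : (a : ℂ) + b ≠ 0 := by exact_mod_cast (add_pos ha hb).ne'
  rw [hsum, hp2, hzeta _ (by omega : 1 ≤ p + 1),
    hzeta p hp]
  -- The end terms k = 0 and k = p are split off: together they give 2u_0u_p with u_0 = a/(a+b), and
  -- 2a/(a+b) - 1 = (a-b)/(a+b).
  rw [Finset.sum_range_succ, Finset.range_eq_Ico, Finset.sum_eq_sum_Ico_succ_bot (by omega),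
    Nat.sub_self, Nat.sub_zero, zero_add] at hcoeff
  rw [mul_comm, ← eq_div_iff hc] at hzero
  rw [hzero] at hcoeff
  field_simp at hcoeff ⊢
  linear_combination hcoeff
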